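/- Let $a:[0,\infty)\to[0,\infty)$ be differentiable and non-increasing with $\lim_{t\to\infty}a(t)=0$, and assume that there is $c>0$ such that $a(t)\ge \frac{c}{t+1}$ for all $t\ge 0$. Let $G:\mathbb{R}\to\mathbb{R}$ be of class $C^1$ and coercive (i.e. $G(\xi)\to\infty$ as $|\xi|\to\infty$), with $G'$ Lipschitz continuous on bounded sets. Assume that (a) $G$ has finitely many critical points; (b) $G$ takes different values at different critical points; (c) near each critical point $p$, $G$ is either strongly convex or strongly concave, where $G$ is called strongly convex near $p$ if there are $\varepsilon,\delta>0$ with $G(y)\ge G(x)+(y-x)G'(x)+\delta(y-x)^2$ for all $x,y\in(p-\varepsilon,p+\varepsilon)$, and strongly concave near $p$ if $-G$ is strongly convex near $p$. Let $x:[0,\infty)\to\mathbb{R}$ be any $C^2$ solution of $$\ddot x(t)+a(t)\,\dot x(t)+G'(x(t))=0,\qquad t\ge 0.$$ Then $\lim_{t\to\infty}x(t)$ exists. Moreover, if $x$ is not constant and $\mathcal{T}$ denotes the set of times $t>0$ at which $\dot x$ changes sign, then the limit is a local maximum point of $G$ if and only if $\mathcal{T}$ is finite, and it is a local minimum point of $G$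 if and only if $\mathcal{T}$ is infinite. -/

import Mathlib

open Set Filter Topology

namespace DampedGradient

/-- `G` is strongly convex in a neighbourhood of `p`:
`G y ≥ G x + (y - x) G'(x) + δ (y - x)²` for all `x, y ∈ ]p - ε, p + ε[`, for some `ε, δ > 0`. -/
def StronglyConvexNear (G : ℝ → ℝ) (p : ℝ) : Prop :=
  ∃ ε > 0, ∃ δ > 0, ∀ x ∈ Ioo (p - ε) (p + ε), ∀ y ∈ Ioo (p - ε) (p + ε),
    G x + (y - x) * deriv G x + δ * (y - x) ^ 2 ≤ G y

/-- `G` is strongly concave in a neighbourhood of `p` if `-G` is strongly convex there. -/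
def StronglyConcaveNear (G : ℝ → ℝ) (p : ℝ) : Prop :=
  StronglyConvexNear (fun x => - G x) p

/-- The velocity of `x : [0, ∞) → ℝ`; one-sided at `t = 0`. -/
noncomputable def velocity (x : ℝ → ℝ) : ℝ → ℝ :=
  derivWithin x (Ici 0)

/-- `x` is a `C²` solution on `[0, ∞)` of `x'' + a(t) x' + G'(x) = 0`.
Only the values of `a` and `x` on `[0, ∞)` matter. -/
structure IsSolution (a G x : ℝ → ℝ) : Prop where
  contDiffOn : ContDiffOn ℝ 2 x (Ici 0)
  equation : ∀ t, 0 ≤ t →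
    derivWithin (velocity x) (Ici 0) t + a t * velocity x t + deriv G (x t) = 0

/-- The times `t > 0` at which `v` changes sign: `v` has one strict sign on an interval
immediately to the left of `t` and the opposite strict sign on one immediately to the right. -/
def signChanges (v : ℝ → ℝ) : Set ℝ :=
  {t | 0 < t ∧ ∃ ε > 0, ε ≤ t ∧
    ∀ r ∈ Ioo (t - ε) t, ∀ s ∈ Ioo t (t + ε), v r * v s < 0}

end DampedGradient

/-!
The energy `E = x'² / 2 + G(x)` decreases to a limit `e`. Away from the equilibria at level `e`,
the lower bound on `a` makes `E` drop by at least `κ / (t + 2)` in unit time. Such drops cannot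
recur forever with waits of length `O(log t)`, since their sum would diverge like `log (log t)`.
Hence `x` accumulates at the unique critical point `p` with `G(p) = e`. If `p` is a strict
minimum, the energy traps `x` near `p`. If `G` is strongly concave near `p`, a visit to a
neighbourhood of `p` that ends at time `t` has length `O(log t)`, because the energy still to be
lost keeps `x` moving; so `x` cannot leave the neighbourhood infinitely often.

By uniqueness for the Cauchy problem, zeros of the velocity of a nonconstant solution are simple,
so they are sign changes and do not accumulate. Near a strict maximum the velocity cannot vanish,
as the energy would then lie below its limit; near a minimum, a solution that avoids `p` would
give a global solution `x' / (x - p)` of a Riccati equation whose solutions blow up.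
-/

namespace DampedGradient

section RealAnalysis

lemma exists_first_mem {α X : Type*} [LinearOrder α] [TopologicalSpace α] [OrderTopology α]
    [CompactIccSpace α] [TopologicalSpace X] {f : α → X} {S : Set X} {t u : α}
    (hf : ContinuousOn f (Icc t u)) (hS : IsClosed S) (htu : t ≤ u) (hu : f u ∈ S) :
    ∃ r ∈ Icc t u, f r ∈ S ∧ ∀ s ∈ Ico t r, f s ∉ S := by
  have hcompact : IsCompact (Icc t u ∩ f ⁻¹' S) :=
    isCompact_Icc.of_isClosed_subset (hf.preimage_isClosed_of_isClosed isClosed_Icc hS)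
      inter_subset_left
  obtain ⟨r, ⟨hr, hrS⟩, hleast⟩ := hcompact.exists_isLeast ⟨u, ⟨htu, le_rfl⟩, hu⟩
  exact ⟨r, hr, hrS, fun s hs hsS => (hleast ⟨⟨hs.1, hs.2.le.trans hr.2⟩, hsS⟩).not_gt hs.2⟩

lemma finite_zeros_of_hasDerivWithinAt_ne_zero {𝕜 F : Type*} [NontriviallyNormedField 𝕜]
    [NormedAddCommGroup F] [NormedSpace 𝕜 F] {f f' : 𝕜 → F} {s : Set 𝕜} (hs : IsCompact s)
    (hf : ∀ t ∈ s, HasDerivWithinAt f (f' t) s t) (hf' : ∀ t ∈ s, f t = 0 → f' t ≠ 0) :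
    {t ∈ s | f t = 0}.Finite := by
  by_contra hinf
  obtain ⟨r, hr, hacc⟩ := Set.Infinite.exists_accPt_of_subset_isCompact hinf hs fun t ht => ht.1
  have hne : ∀ᶠ z in 𝓝[s \ {r}] r, f z ≠ 0 := by
    by_cases hfr : f r = 0
    · exact (hf r hr).eventually_ne (hf' r hr hfr)
    · exact ((hf r hr).continuousWithinAt.mono sdiff_subset).eventually_ne hfr
  rw [accPt_iff_frequently_nhdsNE] at hacc
  rw [eventually_nhdsWithin_iff] at hne
  obtain ⟨z, ⟨hzs, hz⟩, hzr, hzne⟩ := (hacc.and_eventually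
    (eventually_mem_nhdsWithin.and (hne.filter_mono nhdsWithin_le_nhds))).exists
  exact hzne ⟨hzs, hzr⟩ hz

lemma tendsto_of_mapClusterPt_of_strict_min {x G : ℝ → ℝ} {p t₀ : ℝ}
    (hx : ContinuousOn x (Ici t₀)) (hcluster : MapClusterPt p atTop x)
    (hlevel : ∀ b > G p, ∀ᶠ t in atTop, G (x t) < b) (hmin : ∀ᶠ y in 𝓝[≠] p, G p < G y) :
    Tendsto x atTop (𝓝 p) := by
  rw [eventually_nhdsWithin_iff, Metric.eventually_nhds_iff] at hmin
  obtain ⟨ε₀, hε₀, hmin⟩ := hmin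
  rw [Metric.tendsto_atTop']
  intro ε₁ hε₁
  obtain ⟨ε, hε, hεlt⟩ := exists_between (lt_min hε₀ hε₁)
  have hsphere : ∀ y, dist y p = ε → G p < G y := fun y hy =>
    hmin (hy.trans_lt (hεlt.trans_le (min_le_left _ _))) (dist_pos.1 (hy ▸ hε))
  have hbelow := (hlevel (min (G (p - ε)) (G (p + ε)))
    (lt_min (hsphere _ (by simp [hε.le])) (hsphere _ (by simp [hε.le])))).and
      (eventually_ge_atTop t₀)
  obtain ⟨T₀, hT₀⟩ := eventually_atTop.1 hbelow
  obtain ⟨T, hT, hxT⟩ := frequently_atTop.1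
    (mapClusterPt_iff_frequently.1 hcluster _ (Metric.ball_mem_nhds p hε)) T₀
  refine ⟨T, fun t ht => lt_trans ?_ (hεlt.trans_le (min_le_right _ _))⟩
  by_contra! hout
  have hcont : ContinuousOn (fun s => |x s - p|) (Icc T t) :=
    ((hx.mono fun s hs => (hT₀ s (hT.trans hs.1)).2).sub continuousOn_const).abs
  obtain ⟨s, hs, hsε⟩ := intermediate_value_Icc ht.le hcont
    ⟨(Real.dist_eq _ _).ge.trans (le_of_lt hxT), hout⟩
  have hlt := lt_min_iff.1 (hT₀ s (hT.trans hs.1)).1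
  rcases eq_or_eq_neg_of_abs_eq hsε with h | h
  · exact hlt.2.ne (by rw [← h, add_sub_cancel])
  · exact hlt.1.ne (by rw [sub_eq_add_neg, ← h, add_sub_cancel])

lemma exists_neg_mul_one_add_sq_lt_deriv {w w' : ℝ → ℝ} {c T : ℝ} (hc : 0 < c)
    (hw : ∀ t, T ≤ t → HasDerivAt w (w' t) t) : ∃ t ≥ T, -c * (1 + w t ^ 2) < w' t := by
  by_contra! hle
  have hperiod : 0 < Real.pi / c := div_pos Real.pi_pos hc
  have hT : T < T + Real.pi / c := lt_add_of_pos_right T hperiod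
  obtain ⟨r, hr, hslope⟩ := exists_hasDerivAt_eq_slope (fun t => Real.arctan (w t)) _ hT
    (fun t ht => (hw t ht.1).arctan.continuousAt.continuousWithinAt)
    fun t ht => (hw t ht.1.le).arctan
  have hspeed : 1 / (1 + w r ^ 2) * w' r ≤ -c := by
    rw [one_div, ← div_eq_inv_mul, div_le_iff₀ (by positivity)]
    exact hle r hr.1.le
  rw [hslope, add_sub_cancel_left, div_le_iff₀ hperiod, neg_mul, mul_div_cancel₀ _ hc.ne'] at hspeed
  linarith [Real.neg_pi_div_two_lt_arctan (w (T + Real.pi / c)), Real.arctan_lt_pi_div_two (w T)]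

/- Dividing by `√(σ + δ f²)` turns the hypothesis on the speed into a lower bound for the
derivative of `arsinh (f √(δ / σ))`. -/
lemma sqrt_mul_sub_le_two_mul_arsinh {f f' : ℝ → ℝ} {s r δ σ Y : ℝ} (hδ : 0 ≤ δ) (hσ : 0 < σ)
    (hsr : s < r) (hf : ContinuousOn f (Icc s r)) (hf' : ∀ t ∈ Ioo s r, HasDerivAt f (f' t) t)
    (hspeed : ∀ t ∈ Ioo s r, σ + δ * f t ^ 2 ≤ f' t ^ 2) (hs : |f s| ≤ Y) (hr : |f r| ≤ Y) :
    √δ * (r - s) ≤ 2 * Real.arsinh (Y * √(δ / σ)) := by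
  set b := √(δ / σ)
  have hb : 0 ≤ b := Real.sqrt_nonneg _
  have hb2 : b ^ 2 = δ / σ := Real.sq_sqrt (by positivity)
  have habs : ∀ y, |y| ≤ Y → |Real.arsinh (y * b)| ≤ Real.arsinh (Y * b) := by
    intro y hy
    rw [abs_le, ← Real.arsinh_neg, Real.arsinh_le_arsinh, Real.arsinh_le_arsinh, ← neg_mul]
    exact ⟨mul_le_mul_of_nonneg_right (abs_le.1 hy).1 hb,
      mul_le_mul_of_nonneg_right (abs_le.1 hy).2 hb⟩
  obtain ⟨q, hq, hslope⟩ := exists_hasDerivAt_eq_slope (fun t => Real.arsinh (f t * b)) _ hsr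
    (Real.continuous_arsinh.comp_continuousOn (hf.mul continuousOn_const))
    fun t ht => ((hf' t ht).mul_const b).arsinh
  have hderiv : √δ ≤ |(√(1 + (f q * b) ^ 2))⁻¹ * (f' q * b)| := by
    have hpos : 0 < 1 + (f q * b) ^ 2 := by positivity
    rw [Real.sqrt_le_left (abs_nonneg _), sq_abs, mul_pow, inv_pow, Real.sq_sqrt hpos.le,
      ← div_eq_inv_mul, le_div_iff₀ hpos, mul_pow, mul_pow, hb2]
    calc δ * (1 + f q ^ 2 * (δ / σ)) = (σ + δ * f q ^ 2) * (δ / σ) := by field_simp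
      _ ≤ f' q ^ 2 * (δ / σ) := mul_le_mul_of_nonneg_right (hspeed q hq) (by positivity)
  calc √δ * (r - s)
      ≤ |(√(1 + (f q * b) ^ 2))⁻¹ * (f' q * b)| * (r - s) :=
        mul_le_mul_of_nonneg_right hderiv (sub_pos.2 hsr).le
    _ = |Real.arsinh (f r * b) - Real.arsinh (f s * b)| := by
        rw [← smul_eq_mul (a := (√(1 + (f q * b) ^ 2))⁻¹), hslope, abs_div,
          abs_of_pos (sub_pos.2 hsr), div_mul_cancel₀ _ (sub_pos.2 hsr).ne']
    _ ≤ |Real.arsinh (f r * b)| + |Real.arsinh (f s * b)| := abs_sub _ _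
    _ ≤ 2 * Real.arsinh (Y * b) := by linarith [habs _ hs, habs _ hr]

lemma half_lt_log {y : ℝ} (hy : 2 ≤ y) : 1 / 2 < Real.log y := by
  linarith [Real.log_two_gt_d9, Real.log_le_log two_pos hy]

lemma exists_arsinh_mul_sqrt_le_mul_log {B : ℝ} (hB : 0 ≤ B) :
    ∃ C ≥ 0, ∀ y ≥ 2, Real.arsinh (B * √y) ≤ C * Real.log y := by
  have hlogB : 0 ≤ Real.log (1 + 2 * B) := Real.log_nonneg (by linarith)
  refine ⟨2 * Real.log (1 + 2 * B) + 1, by positivity, fun y hy => ?_⟩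
  have hsqrt : √y ≤ y := Real.sqrt_le_iff.2 ⟨by positivity, by nlinarith⟩
  have hsq : √(1 + (B * √y) ^ 2) ≤ 1 + B * √y := by
    rw [Real.sqrt_le_left (by positivity)]
    nlinarith [mul_nonneg hB (Real.sqrt_nonneg y)]
  calc Real.arsinh (B * √y)
      ≤ Real.log ((1 + 2 * B) * y) := by
        refine Real.log_le_log (by positivity) ?_
        nlinarith [mul_le_mul_of_nonneg_left hsqrt hB]
    _ = Real.log (1 + 2 * B) + Real.log y := Real.log_mul (by positivity) (by positivity)
    _ ≤ (2 * Real.log (1 + 2 * B) + 1) * Real.log y := by nlinarith [half_lt_log hy]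

end RealAnalysis

section Dissipation

lemma not_forall_exists_sub_le_sub {E φ : ℝ → ℝ} {T m : ℝ} (hE : ∀ t, T ≤ t → m ≤ E t)
    (hφ : Tendsto φ atTop atTop) : ¬ ∀ t ≥ T, ∃ u ≥ t + 1, φ u - φ t ≤ E t - E u := by
  intro hstep
  have hiter : ∀ n : ℕ, ∃ u ≥ T + n, E u + φ u ≤ E T + φ T := by
    intro n
    induction n with
    | zero => exact ⟨T, by simp, le_rfl⟩
    | succ n ih =>
      obtain ⟨t, ht, hEt⟩ := ih
      obtain ⟨u, hu, hEu⟩ := hstep t (by linarith [(n.cast_nonneg : (0 : ℝ) ≤ n)])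
      exact ⟨u, by push_cast; linarith, by linarith⟩
  obtain ⟨N, hN⟩ := eventually_atTop.1 (hφ.eventually_gt_atTop (E T + φ T - m))
  obtain ⟨n, hn⟩ := exists_nat_ge (N - T)
  obtain ⟨u, hu, hEu⟩ := hiter n
  linarith [hN u (by linarith), hE u (by linarith [(n.cast_nonneg : (0 : ℝ) ≤ n)])]

lemma log_sub_log_le {y z : ℝ} (hy : 0 < y) (hz : 0 < z) :
    Real.log z - Real.log y ≤ (z - y) / y := by
  have := Real.log_le_sub_one_of_pos (div_pos hz hy)
  rwa [Real.log_div hz.ne' hy.ne', ← div_self hy.ne', ← sub_div] at this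

lemma eventually_log_log_sub_le {C : ℝ} (hC : 0 ≤ C) :
    ∀ᶠ y in atTop, ∀ z ≥ y, z ≤ y + C * Real.log z →
      Real.log (Real.log (z + 1)) - Real.log (Real.log y) ≤ (4 * C + 4) / z := by
  have hlog : ∀ᶠ z : ℝ in atTop, C * Real.log z ≤ z / 2 := by
    filter_upwards [(Real.isLittleO_log_id_atTop.const_mul_left C).bound one_half_pos,
      eventually_ge_atTop 0] with z hz hz0
    simpa [abs_of_nonneg hz0, div_eq_inv_mul] using (le_abs_self _).trans hz
  filter_upwards [eventually_forall_ge_atTop.2 hlog, eventually_ge_atTop 2] with y hy hy2 z hyz hz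
  have hy0 : 0 < y := by linarith
  have hlogy := half_lt_log hy2
  have hz2 : z ≤ 2 * y := by linarith [hy z hyz]
  have hlogz : Real.log z ≤ 2 * Real.log y := by
    have := Real.log_le_log (by linarith) hz2
    rw [Real.log_mul two_ne_zero hy0.ne'] at this
    linarith [Real.log_le_log two_pos hy2]
  have hgap : z + 1 - y ≤ (2 * C + 2) * Real.log y := by nlinarith
  calc Real.log (Real.log (z + 1)) - Real.log (Real.log y)
      ≤ (Real.log (z + 1) - Real.log y) / Real.log y :=
        log_sub_log_le (by linarith) (by linarith [half_lt_log (by linarith : 2 ≤ z + 1)])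
    _ ≤ (z + 1 - y) / y / Real.log y := by
        have := log_sub_log_le hy0 (by linarith : 0 < z + 1)
        gcongr
    _ ≤ (2 * C + 2) * Real.log y / y / Real.log y := by gcongr
    _ = (4 * C + 4) / (2 * y) := by field_simp; ring
    _ ≤ (4 * C + 4) / z := by gcongr; linarith

/- The drops `κ / (s + 2)` dominate the increments of a multiple of `log (log (t + 2))`, which is
unbounded. -/
lemma not_eventually_drop_after_log_wait {E : ℝ → ℝ} {t₀ κ C : ℝ} (hE : AntitoneOn E (Ici t₀))
    (hbelow : BddBelow (E '' Ici t₀)) (hκ : 0 < κ) (hC : 0 ≤ C) :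
    ¬ ∀ᶠ t in atTop, ∃ s ≥ t, s ≤ t + C * Real.log (s + 2) ∧ κ / (s + 2) ≤ E s - E (s + 1) := by
  intro hdrop
  obtain ⟨m, hm⟩ := hbelow
  have hloglog : Tendsto (fun t : ℝ => Real.log (Real.log (t + 2))) atTop atTop :=
    Real.tendsto_log_atTop.comp (Real.tendsto_log_atTop.comp
      (tendsto_atTop_add_const_right _ _ tendsto_id))
  have hincr : ∀ᶠ t in atTop, ∀ z ≥ t + 2, z ≤ t + 2 + C * Real.log z →
      Real.log (Real.log (z + 1)) - Real.log (Real.log (t + 2)) ≤ (4 * C + 4) / z :=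
    (tendsto_atTop_add_const_right _ 2 tendsto_id).eventually (eventually_log_log_sub_le hC)
  obtain ⟨T, hT⟩ := eventually_atTop.1 (hdrop.and (hincr.and (eventually_ge_atTop t₀)))
  refine not_forall_exists_sub_le_sub (fun t ht => hm (mem_image_of_mem E (hT t ht).2.2))
    (hloglog.const_mul_atTop (by positivity : 0 < κ / (4 * C + 4))) fun t ht => ?_
  obtain ⟨⟨s, hts, hwait, hs⟩, hincr, ht₀⟩ := hT t ht
  refine ⟨s + 1, by linarith, ?_⟩
  have hgain := hincr (s + 2) (by linarith) (by linarith)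
  rw [add_right_comm s 2 1] at hgain
  calc κ / (4 * C + 4) * Real.log (Real.log (s + 1 + 2))
          - κ / (4 * C + 4) * Real.log (Real.log (t + 2))
      ≤ κ / (4 * C + 4) * ((4 * C + 4) / (s + 2)) := by
        rw [← mul_sub]
        exact mul_le_mul_of_nonneg_left hgain (by positivity)
    _ = κ / (s + 2) := by field_simp
    _ ≤ E t - E (s + 1) := by linarith [hE ht₀ (ht₀.trans hts) hts]

end Dissipation

section Solution

variable {a G x : ℝ → ℝ} {t : ℝ}

/-- The mechanical energy `x'(t)² / 2 + G (x t)` of a motion `x` in the potential `G`. -/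
noncomputable def energy (G x : ℝ → ℝ) (t : ℝ) : ℝ := velocity x t ^ 2 / 2 + G (x t)

lemma potential_le_energy : G (x t) ≤ energy G x t :=
  le_add_of_nonneg_left (by positivity)

namespace IsSolution

lemma hasDerivWithinAt (h : IsSolution a G x) (ht : 0 ≤ t) :
    HasDerivWithinAt x (velocity x t) (Ici 0) t :=
  (h.contDiffOn.differentiableOn two_ne_zero t ht).hasDerivWithinAt

lemma hasDerivWithinAt_velocity (h : IsSolution a G x) (ht : 0 ≤ t) :
    HasDerivWithinAt (velocity x) (-(a t * velocity x t) - deriv G (x t)) (Ici 0) t := by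
  have hC1 : ContDiffOn ℝ 1 (velocity x) (Ici 0) :=
    h.contDiffOn.derivWithin (uniqueDiffOn_Ici 0) (by norm_num)
  refine (hC1.differentiableOn one_ne_zero t ht).hasDerivWithinAt.congr_deriv ?_
  linarith [h.equation t ht]

lemma hasDerivAt (h : IsSolution a G x) (ht : 0 < t) : HasDerivAt x (velocity x t) t :=
  (h.hasDerivWithinAt ht.le).hasDerivAt (Ici_mem_nhds ht)

lemma hasDerivAt_velocity (h : IsSolution a G x) (ht : 0 < t) :
    HasDerivAt (velocity x) (-(a t * velocity x t) - deriv G (x t)) t :=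
  (h.hasDerivWithinAt_velocity ht.le).hasDerivAt (Ici_mem_nhds ht)

lemma continuousOn (h : IsSolution a G x) : ContinuousOn x (Ici 0) :=
  h.contDiffOn.continuousOn

lemma continuousOn_velocity (h : IsSolution a G x) : ContinuousOn (velocity x) (Ici 0) :=
  fun _ ht => (h.hasDerivWithinAt_velocity ht).continuousWithinAt

lemma exists_sub_eq_velocity_mul (h : IsSolution a G x) {s : ℝ} (hs : 0 ≤ s) (hst : s < t) :
    ∃ r ∈ Ioo s t, x t - x s = velocity x r * (t - s) := by
  obtain ⟨r, hr, hslope⟩ := exists_hasDerivAt_eq_slope x (velocity x) hst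
    (h.continuousOn.mono fun u hu => hs.trans hu.1) fun u hu => h.hasDerivAt (hs.trans_lt hu.1)
  exact ⟨r, hr, (eq_div_iff (sub_pos.2 hst).ne').1 hslope |>.symm⟩

lemma exists_velocity_sub_eq_mul (h : IsSolution a G x) {s : ℝ} (hs : 0 ≤ s) (hst : s < t) :
    ∃ r ∈ Ioo s t, velocity x t - velocity x s =
      (-(a r * velocity x r) - deriv G (x r)) * (t - s) := by
  obtain ⟨r, hr, hslope⟩ := exists_hasDerivAt_eq_slope (velocity x) _ hst
    (h.continuousOn_velocity.mono fun u hu => hs.trans hu.1)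
    fun u hu => h.hasDerivAt_velocity (hs.trans_lt hu.1)
  exact ⟨r, hr, (eq_div_iff (sub_pos.2 hst).ne').1 hslope |>.symm⟩

lemma hasDerivAt_energy (h : IsSolution a G x) (hG : DifferentiableAt ℝ G (x t)) (ht : 0 < t) :
    HasDerivAt (energy G x) (-(a t * velocity x t ^ 2)) t := by
  refine ((((h.hasDerivAt_velocity ht).pow 2).div_const 2).add
    (hG.hasDerivAt.comp t (h.hasDerivAt ht))).congr_deriv ?_
  push_cast
  ring

lemma continuousOn_energy (h : IsSolution a G x) (hG : Continuous G) :
    ContinuousOn (energy G x) (Ici 0) :=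
  ((h.continuousOn_velocity.pow 2).div_const 2).add (hG.comp_continuousOn h.continuousOn)

lemma exists_energy_sub_eq_mul (h : IsSolution a G x) (hG : Differentiable ℝ G) {s : ℝ}
    (hs : 0 ≤ s) (hst : s < t) :
    ∃ r ∈ Ioo s t, energy G x s - energy G x t = a r * velocity x r ^ 2 * (t - s) := by
  obtain ⟨r, hr, hslope⟩ := exists_hasDerivAt_eq_slope (energy G x) _ hst
    ((h.continuousOn_energy hG.continuous).mono fun u hu => hs.trans hu.1)
    fun u hu => h.hasDerivAt_energy (hG _) (hs.trans_lt hu.1)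
  rw [eq_div_iff (sub_pos.2 hst).ne'] at hslope
  exact ⟨r, hr, by linarith⟩

lemma antitoneOn_energy (h : IsSolution a G x) (hG : Differentiable ℝ G)
    (ha : ∀ t, 0 ≤ t → 0 ≤ a t) : AntitoneOn (energy G x) (Ici 0) := by
  intro s hs t _ hst
  rcases hst.eq_or_lt with rfl | hst
  · exact le_rfl
  obtain ⟨r, hr, hdrop⟩ := h.exists_energy_sub_eq_mul hG hs hst
  exact sub_nonneg.1 (hdrop ▸ mul_nonneg
    (mul_nonneg (ha r ((mem_Ici.1 hs).trans hr.1.le)) (sq_nonneg _)) (sub_pos.2 hst).le)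

lemma isBounded_image (h : IsSolution a G x) (hG : Differentiable ℝ G)
    (ha : ∀ t, 0 ≤ t → 0 ≤ a t) (hcoercive : Tendsto G (Bornology.cobounded ℝ) atTop) :
    Bornology.IsBounded (x '' Ici 0) := by
  have hsublevel : Bornology.IsBounded {y | energy G x 0 < G y}ᶜ :=
    Bornology.isBounded_compl_iff.2 (hcoercive.eventually_gt_atTop _)
  refine hsublevel.subset ?_
  rintro _ ⟨t, ht, rfl⟩
  exact not_lt.2 (potential_le_energy.trans
    (h.antitoneOn_energy hG ha self_mem_Ici ht ht))

end IsSolution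

open scoped NNReal

lemma lipschitzOnWith_damped_field {g : ℝ → ℝ} {s : Set ℝ} {K A : ℝ≥0} {α : ℝ} (hα : ‖α‖₊ ≤ A)
    (hg : LipschitzOnWith K g s) :
    LipschitzOnWith (max 1 (A + K)) (fun z : ℝ × ℝ => (z.2, -(α * z.2) - g z.1))
      (s ×ˢ univ) := by
  refine LipschitzWith.prod_snd.lipschitzOnWith.prodMk (LipschitzOnWith.sub ?_ ?_)
  · refine (LipschitzWith.of_dist_le_mul fun y z => ?_).lipschitzOnWith
    rw [dist_neg_neg, Real.dist_eq, ← mul_sub, abs_mul]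
    exact mul_le_mul hα ((Real.dist_eq _ _).ge.trans (le_max_right _ _)) (abs_nonneg _) A.2
  · exact mul_one K ▸ hg.comp LipschitzWith.prod_fst.lipschitzOnWith fun z hz => hz.1

lemma IsSolution.eq_of_equilibrium (h : IsSolution a G x) {A K : ℝ≥0} {r : ℝ}
    (ha : ∀ t, 0 ≤ t → ‖a t‖₊ ≤ A) (hG : LipschitzOnWith K (deriv G) (x '' Ici 0)) (hr : 0 ≤ r)
    (hv : velocity x r = 0) (hg : deriv G (x r) = 0) (ht : 0 ≤ t) : x t = x r := by
  let field : ℝ → ℝ × ℝ → ℝ × ℝ := fun t z => (z.2, -(a t * z.2) - deriv G z.1)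
  let state : ℝ → ℝ × ℝ := fun t => (x t, velocity x t)
  have hfield : ∀ s, 0 ≤ s → LipschitzOnWith (max 1 (A + K)) (field s) ((x '' Ici 0) ×ˢ univ) :=
    fun s hs => lipschitzOnWith_damped_field (ha s hs) hG
  have hcont : ContinuousOn state (Ici 0) := h.continuousOn.prodMk h.continuousOn_velocity
  have hstate : ∀ s, 0 ≤ s → HasDerivWithinAt state (field s (state s)) (Ici 0) s :=
    fun s hs => (h.hasDerivWithinAt hs).prodMk (h.hasDerivWithinAt_velocity hs)
  have hmem : ∀ s, 0 ≤ s → state s ∈ (x '' Ici 0) ×ˢ univ :=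
    fun s hs => ⟨mem_image_of_mem x hs, mem_univ _⟩
  have hrest : ∀ s (S : Set ℝ), HasDerivWithinAt (fun _ => state r) (field s (state r)) S s := by
    intro s S
    refine (hasDerivWithinAt_const s S (state r)).congr_deriv ?_
    simp only [field, state, hv, hg, mul_zero, neg_zero, sub_zero, Prod.mk_zero_zero]
  suffices state t = state r from congrArg Prod.fst this
  rcases le_total r t with hrt | htr
  · exact ODE_solution_unique_of_mem_Icc_right (fun s hs => hfield s (hr.trans hs.1))
      (hcont.mono fun s hs => hr.trans hs.1)
      (fun s hs => (hstate s (hr.trans hs.1)).mono (Ici_subset_Ici.2 (hr.trans hs.1)))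
      (fun s hs => hmem s (hr.trans hs.1)) continuousOn_const (fun s _ => hrest s _)
      (fun _ _ => hmem r hr) rfl ⟨hrt, le_rfl⟩
  · exact ODE_solution_unique_of_mem_Icc_left (fun s hs => hfield s (ht.trans hs.1.le))
      (hcont.mono fun s hs => ht.trans hs.1)
      (fun s hs => ((hstate s (ht.trans hs.1.le)).hasDerivAt
        (Ici_mem_nhds (ht.trans_lt hs.1))).hasDerivWithinAt)
      (fun s hs => hmem s (ht.trans hs.1.le)) continuousOn_const (fun s _ => hrest s _)
      (fun _ _ => hmem r hr) rfl ⟨le_rfl, htr⟩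

/- If the motion stays slow, the force is almost constant, hence small: it would otherwise
accelerate the motion. -/
lemma IsSolution.abs_deriv_le_of_abs_velocity_le (h : IsSolution a G x) {A ν : ℝ} {K : ℝ≥0}
    (ha : ∀ t, 0 ≤ t → |a t| ≤ A) (hG : LipschitzOnWith K (deriv G) (x '' Ici 0)) (ht : 0 ≤ t)
    (hslow : ∀ s ∈ Icc t (t + 1 / 2), |velocity x s| ≤ ν) :
    |deriv G (x t)| ≤ (4 + A + K) * ν := by
  have hlt : t < t + 1 / 2 := by linarith
  obtain ⟨r, hr, hr_eq⟩ := h.exists_velocity_sub_eq_mul ht hlt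
  obtain ⟨q, hq, hq_eq⟩ := h.exists_sub_eq_velocity_mul ht hr.1
  have hr0 : 0 ≤ r := ht.trans hr.1.le
  have hforce : |deriv G (x r) - deriv G (x t)| ≤ K * ν := by
    have hdist := hG.dist_le_mul _ (mem_image_of_mem x hr0) _ (mem_image_of_mem x ht)
    rw [Real.dist_eq, Real.dist_eq, hq_eq, abs_mul, abs_of_pos (sub_pos.2 hr.1)] at hdist
    refine hdist.trans (mul_le_mul_of_nonneg_left ?_ K.2)
    nlinarith [hslow q ⟨hq.1.le, hq.2.le.trans hr.2.le⟩, abs_nonneg (velocity x q), hr.1, hr.2]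
  have hfriction : |a r * velocity x r| ≤ A * ν := by
    rw [abs_mul]
    exact mul_le_mul (ha r hr0) (hslow r ⟨hr.1.le, hr.2.le⟩) (abs_nonneg _)
      ((abs_nonneg _).trans (ha r hr0))
  have hstart := abs_le.1 (hslow t ⟨le_rfl, hlt.le⟩)
  have hend := abs_le.1 (hslow _ ⟨hlt.le, le_rfl⟩)
  rw [abs_le] at hforce hfriction ⊢
  constructor <;> linarith

end Solution

section BoundedSolution

variable {a G x : ℝ → ℝ}

/-- A bounded solution `x` of `x'' + a(t) x' + G'(x) = 0` whose damping `a` is bounded and decays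
no faster than `c / (t + 1)`: the setting of the convergence proof. Lipschitz continuity of `G'`
is imposed only on the range of `x`. -/
structure IsBoundedSolution (a G x : ℝ → ℝ) : Prop extends IsSolution a G x where
  contDiff : ContDiff ℝ 1 G
  isBounded_image : Bornology.IsBounded (x '' Ici 0)
  lipschitz : ∃ K, LipschitzOnWith K (deriv G) (x '' Ici 0)
  bddAbove_damping : BddAbove (a '' Ici 0)
  damping_lower : ∃ c > 0, ∀ t, 0 ≤ t → c / (t + 1) ≤ a t

namespace IsBoundedSolution

lemma damping_nonneg (h : IsBoundedSolution a G x) (t : ℝ) (ht : 0 ≤ t) : 0 ≤ a t := by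
  obtain ⟨c, hc, hca⟩ := h.damping_lower
  exact le_trans (by positivity) (hca t ht)

lemma exists_damping_le (h : IsBoundedSolution a G x) : ∃ A ≥ 0, ∀ t, 0 ≤ t → a t ≤ A := by
  obtain ⟨A, hA⟩ := h.bddAbove_damping
  have ha : ∀ t, 0 ≤ t → a t ≤ A := fun t ht => hA (mem_image_of_mem a ht)
  exact ⟨A, (h.damping_nonneg 0 le_rfl).trans (ha 0 le_rfl), ha⟩

lemma differentiable (h : IsBoundedSolution a G x) : Differentiable ℝ G :=
  h.contDiff.differentiable one_ne_zero

lemma isCompact_closure (h : IsBoundedSolution a G x) : IsCompact (closure (x '' Ici 0)) :=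
  h.isBounded_image.isCompact_closure

lemma mem_closure (t : ℝ) (ht : 0 ≤ t) : x t ∈ closure (x '' Ici 0) :=
  subset_closure (mem_image_of_mem x ht)

lemma eq_of_equilibrium (h : IsBoundedSolution a G x) {r t : ℝ} (hr : 0 ≤ r)
    (hv : velocity x r = 0) (hg : deriv G (x r) = 0) (ht : 0 ≤ t) : x t = x r := by
  obtain ⟨A, hA, ha⟩ := h.exists_damping_le
  obtain ⟨K, hK⟩ := h.lipschitz
  refine h.toIsSolution.eq_of_equilibrium (A := ⟨A, hA⟩) (fun t ht => ?_) hK hr hv hg ht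
  exact (Real.norm_of_nonneg (h.damping_nonneg t ht)).trans_le (ha t ht)

lemma antitoneOn_energy (h : IsBoundedSolution a G x) : AntitoneOn (energy G x) (Ici 0) :=
  h.toIsSolution.antitoneOn_energy h.differentiable h.damping_nonneg

lemma exists_le_potential (h : IsBoundedSolution a G x) : ∃ m, ∀ t, 0 ≤ t → m ≤ G (x t) := by
  obtain ⟨m, hm⟩ := h.isCompact_closure.bddBelow_image h.contDiff.continuous.continuousOn
  exact ⟨m, fun t ht => hm (mem_image_of_mem G (mem_closure t ht))⟩

lemma bddBelow_energy (h : IsBoundedSolution a G x) : BddBelow (energy G x '' Ici 0) := by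
  obtain ⟨m, hm⟩ := h.exists_le_potential
  refine ⟨m, ?_⟩
  rintro _ ⟨t, ht, rfl⟩
  exact (hm t ht).trans potential_le_energy

lemma exists_tendsto_energy (h : IsBoundedSolution a G x) :
    ∃ e, Tendsto (energy G x) atTop (𝓝 e) := by
  have hanti : Antitone fun t => energy G x (max t 0) := fun s t hst =>
    h.antitoneOn_energy (mem_Ici.2 (le_max_right _ _)) (mem_Ici.2 (le_max_right _ _))
      (max_le_max_right 0 hst)
  have hbdd : BddBelow (range fun t => energy G x (max t 0)) :=
    h.bddBelow_energy.mono (range_subset_iff.2 fun t => mem_image_of_mem _ (le_max_right t 0))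
  refine ⟨_, (tendsto_atTop_ciInf hanti hbdd).congr' ?_⟩
  filter_upwards [eventually_ge_atTop 0] with t ht
  rw [max_eq_left ht]

lemma le_energy (h : IsBoundedSolution a G x) {e t : ℝ} (he : Tendsto (energy G x) atTop (𝓝 e))
    (ht : 0 ≤ t) : e ≤ energy G x t := by
  refine le_of_tendsto he ?_
  filter_upwards [eventually_ge_atTop t] with s hs
  exact h.antitoneOn_energy ht (ht.trans hs) hs

lemma exists_abs_velocity_le (h : IsBoundedSolution a G x) :
    ∃ V, ∀ t, 0 ≤ t → |velocity x t| ≤ V := by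
  obtain ⟨m, hm⟩ := h.exists_le_potential
  refine ⟨√(2 * (energy G x 0 - m)), fun t ht => Real.abs_le_sqrt ?_⟩
  have henergy : velocity x t ^ 2 / 2 + G (x t) ≤ energy G x 0 :=
    h.antitoneOn_energy self_mem_Ici ht ht
  linarith [hm t ht]

lemma exists_lipschitzOnWith_velocity (h : IsBoundedSolution a G x) :
    ∃ B, LipschitzOnWith B (velocity x) (Ici 0) := by
  obtain ⟨A, hA, ha⟩ := h.exists_damping_le
  obtain ⟨V, hV⟩ := h.exists_abs_velocity_le
  obtain ⟨g, hg⟩ := h.isCompact_closure.exists_bound_of_continuousOn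
    (h.contDiff.continuous_deriv le_rfl).continuousOn
  refine ⟨Real.toNNReal (A * V + g), (convex_Ici 0).lipschitzOnWith_of_nnnorm_hasDerivWithin_le
    (fun t ht => h.hasDerivWithinAt_velocity ht) fun t ht => ?_⟩
  rw [← NNReal.coe_le_coe, coe_nnnorm]
  refine le_trans ?_ (Real.le_coe_toNNReal _)
  calc ‖-(a t * velocity x t) - deriv G (x t)‖
      ≤ ‖a t * velocity x t‖ + ‖deriv G (x t)‖ := (norm_sub_le _ _).trans_eq (by rw [norm_neg])
    _ ≤ A * V + g := by
        rw [norm_mul, Real.norm_of_nonneg (h.damping_nonneg t ht)]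
        exact add_le_add (mul_le_mul (ha t ht) (hV t ht) (norm_nonneg _) hA)
          (hg _ (mem_closure t ht))

lemma exists_dissipation_of_le_abs_velocity (h : IsBoundedSolution a G x) {ν : ℝ} (hν : 0 < ν) :
    ∃ κ > 0, ∀ s, 0 ≤ s → ν ≤ |velocity x s| →
      κ / (s + 3 / 2) ≤ energy G x s - energy G x (s + 1 / 2) := by
  obtain ⟨c, hc, hca⟩ := h.damping_lower
  obtain ⟨B, hB⟩ := h.exists_lipschitzOnWith_velocity
  obtain ⟨τ, hτ, hτ_half, hBτ⟩ : ∃ τ > 0, τ ≤ 1 / 2 ∧ B * τ ≤ ν / 2 := by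
    refine ⟨min (1 / 2) (ν / (2 * (B + 1))), by positivity, min_le_left _ _, ?_⟩
    calc (B : ℝ) * min (1 / 2) (ν / (2 * (B + 1)))
        ≤ (B + 1) * (ν / (2 * (B + 1))) :=
          mul_le_mul (by linarith) (min_le_right _ _) (by positivity) (by positivity)
      _ = ν / 2 := by field_simp
  refine ⟨c * (ν / 2) ^ 2 * τ, by positivity, fun s hs hνs => ?_⟩
  obtain ⟨r, hr, hdrop⟩ := h.exists_energy_sub_eq_mul h.differentiable hs
    (lt_add_of_pos_right s hτ)
  have hr0 : 0 ≤ r := hs.trans hr.1.le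
  have hfast : ν / 2 ≤ |velocity x r| := by
    have hchange := hB.dist_le_mul s hs r hr0
    rw [Real.dist_eq, Real.dist_eq, abs_sub_comm s r, abs_of_pos (sub_pos.2 hr.1)] at hchange
    have : (B : ℝ) * (r - s) ≤ B * τ := mul_le_mul_of_nonneg_left (by linarith [hr.2]) B.2
    linarith [abs_sub_abs_le_abs_sub (velocity x s) (velocity x r)]
  calc c * (ν / 2) ^ 2 * τ / (s + 3 / 2) = c / (s + 3 / 2) * (ν / 2) ^ 2 * τ := by ring
    _ ≤ a r * velocity x r ^ 2 * (s + τ - s) := by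
        rw [← sq_abs (velocity x r), add_sub_cancel_left]
        have hdamp : c / (s + 3 / 2) ≤ a r :=
          (div_le_div_of_nonneg_left hc.le (by linarith) (by linarith [hr.2])).trans (hca r hr0)
        have hnonneg := h.damping_nonneg r hr0
        gcongr
    _ = energy G x s - energy G x (s + τ) := hdrop.symm
    _ ≤ energy G x s - energy G x (s + 1 / 2) := by
        linarith [h.antitoneOn_energy (mem_Ici.2 (by linarith : 0 ≤ s + τ))
          (mem_Ici.2 (by linarith : 0 ≤ s + 1 / 2)) (by linarith)]

lemma exists_le_abs_velocity_of_off_equilibrium (h : IsBoundedSolution a G x) {μ : ℝ}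
    (hμ : 0 < μ) :
    ∃ ν > 0, ∀ t, 0 ≤ t → μ ≤ velocity x t ^ 2 + deriv G (x t) ^ 2 →
      ∃ s ∈ Icc t (t + 1 / 2), ν ≤ |velocity x s| := by
  obtain ⟨A, hA, ha⟩ := h.exists_damping_le
  obtain ⟨K, hK⟩ := h.lipschitz
  have hpos : 0 < μ / (1 + (4 + A + K) ^ 2) := by positivity
  refine ⟨√(μ / (1 + (4 + A + K) ^ 2)), Real.sqrt_pos.2 hpos, fun t ht hoff => ?_⟩
  set ν := √(μ / (1 + (4 + A + K) ^ 2))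
  have hν : ν ^ 2 * (1 + (4 + A + K) ^ 2) = μ := by
    rw [Real.sq_sqrt hpos.le, div_mul_cancel₀ _ (by positivity)]
  by_contra! hslow
  have hforce := h.abs_deriv_le_of_abs_velocity_le
    (fun t ht => (abs_of_nonneg (h.damping_nonneg t ht)).trans_le (ha t ht)) hK ht
    fun s hs => (hslow s hs).le
  have hv_sq : velocity x t ^ 2 < ν ^ 2 :=
    sq_lt_sq.2 ((hslow t ⟨le_rfl, by linarith⟩).trans_le (le_abs_self ν))
  have hforce_sq : deriv G (x t) ^ 2 ≤ ((4 + A + K) * ν) ^ 2 :=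
    sq_le_sq.2 (hforce.trans (le_abs_self _))
  linarith

lemma exists_dissipation_of_off_equilibrium (h : IsBoundedSolution a G x) {μ : ℝ} (hμ : 0 < μ) :
    ∃ κ > 0, ∀ t, 0 ≤ t → μ ≤ velocity x t ^ 2 + deriv G (x t) ^ 2 →
      κ / (t + 2) ≤ energy G x t - energy G x (t + 1) := by
  obtain ⟨ν, hν, hfast⟩ := h.exists_le_abs_velocity_of_off_equilibrium hμ
  obtain ⟨κ, hκ, hdrop⟩ := h.exists_dissipation_of_le_abs_velocity hν
  refine ⟨κ, hκ, fun t ht hoff => ?_⟩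
  obtain ⟨s, hs, hνs⟩ := hfast t ht hoff
  have hs0 : 0 ≤ s := ht.trans hs.1
  calc κ / (t + 2) ≤ κ / (s + 3 / 2) :=
        div_le_div_of_nonneg_left hκ.le (by linarith) (by linarith [hs.2])
    _ ≤ energy G x s - energy G x (s + 1 / 2) := hdrop s hs0 hνs
    _ ≤ energy G x t - energy G x (t + 1) :=
        sub_le_sub (h.antitoneOn_energy ht hs0 hs.1)
          (h.antitoneOn_energy (mem_Ici.2 (by linarith)) (mem_Ici.2 (by linarith))
            (by linarith [hs.2]))

lemma eventually_dissipation_of_mem (h : IsBoundedSolution a G x) {e : ℝ}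
    (he : Tendsto (energy G x) atTop (𝓝 e)) {S : Set ℝ} (hS : IsClosed S)
    (hSe : ∀ q ∈ S, deriv G q = 0 → G q ≠ e) :
    ∃ κ > 0, ∀ᶠ t in atTop, x t ∈ S → κ / (t + 2) ≤ energy G x t - energy G x (t + 1) := by
  have hcont : Continuous fun y => |G y - e| + deriv G y ^ 2 :=
    (h.contDiff.continuous.sub continuous_const).abs.add
      ((h.contDiff.continuous_deriv le_rfl).pow 2)
  have hpos : ∀ y ∈ closure (x '' Ici 0) ∩ S, 0 < |G y - e| + deriv G y ^ 2 := by
    intro y hy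
    by_cases hg : deriv G y = 0
    · exact add_pos_of_pos_of_nonneg (abs_pos.2 (sub_ne_zero.2 (hSe y hy.2 hg))) (sq_nonneg _)
    · positivity
  obtain ⟨m, hm, hmin⟩ :=
    (h.isCompact_closure.inter_right hS).exists_forall_le' hcont.continuousOn hpos
  obtain ⟨κ, hκ, hdrop⟩ := h.exists_dissipation_of_off_equilibrium (half_pos hm)
  refine ⟨κ, hκ, ?_⟩
  filter_upwards [eventually_ge_atTop 0,
    he.eventually_lt_const (lt_add_of_pos_right e (half_pos hm))]
    with t ht henergy hxS
  refine hdrop t ht ?_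
  have hlevel : |G (x t) - e| ≤ m / 2 + velocity x t ^ 2 := by
    have hbelow := h.le_energy he ht
    rw [energy] at henergy hbelow
    rw [abs_le]
    constructor <;> nlinarith [sq_nonneg (velocity x t)]
  linarith [hmin (x t) ⟨mem_closure t ht, hxS⟩]

lemma frequently_notMem (h : IsBoundedSolution a G x) {e : ℝ}
    (he : Tendsto (energy G x) atTop (𝓝 e)) {S : Set ℝ} (hS : IsClosed S)
    (hSe : ∀ q ∈ S, deriv G q = 0 → G q ≠ e) : ∃ᶠ t in atTop, x t ∉ S := by
  intro hmem
  obtain ⟨κ, hκ, hdrop⟩ := h.eventually_dissipation_of_mem he hS hSe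
  refine not_eventually_drop_after_log_wait h.antitoneOn_energy h.bddBelow_energy hκ le_rfl ?_
  filter_upwards [hmem, hdrop] with t ht hdrop
  exact ⟨t, le_rfl, by simp, hdrop (not_not.1 ht)⟩

lemma exists_equilibrium (h : IsBoundedSolution a G x) {e : ℝ}
    (he : Tendsto (energy G x) atTop (𝓝 e)) : ∃ p, deriv G p = 0 ∧ G p = e := by
  by_contra! hne
  exact (h.frequently_notMem he isClosed_univ fun q _ => hne q).exists.elim
    fun t ht => ht (mem_univ _)

lemma mapClusterPt (h : IsBoundedSolution a G x) {p : ℝ}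
    (he : Tendsto (energy G x) atTop (𝓝 (G p))) (hp : ∀ q, deriv G q = 0 → G q = G p → q = p) :
    MapClusterPt p atTop x := by
  rw [mapClusterPt_iff_frequently]
  intro U hU
  refine (h.frequently_notMem he (isOpen_interior (s := U)).isClosed_compl
    fun q hq hg hlevel => hq ?_).mono fun t ht => interior_subset (not_not.1 ht)
  exact hp q hg hlevel ▸ mem_interior_iff_mem_nhds.2 hU

end IsBoundedSolution

end BoundedSolution

section LocalShape

variable {G : ℝ → ℝ} {p : ℝ}

lemma StronglyConvexNear.exists_eventually_add_sq_le (h : StronglyConvexNear G p)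
    (hp : deriv G p = 0) : ∃ δ > 0, ∀ᶠ y in 𝓝 p, G p + δ * (y - p) ^ 2 ≤ G y := by
  obtain ⟨ε, hε, δ, hδ, hconv⟩ := h
  have hnhds : Ioo (p - ε) (p + ε) ∈ 𝓝 p := Ioo_mem_nhds (by linarith) (by linarith)
  refine ⟨δ, hδ, mem_of_superset hnhds fun y hy => ?_⟩
  simpa [hp] using hconv p (mem_of_mem_nhds hnhds) y hy

lemma StronglyConvexNear.exists_eventually_mul_sq_le_mul_deriv (h : StronglyConvexNear G p)
    (hp : deriv G p = 0) : ∃ δ > 0, ∀ᶠ y in 𝓝 p, δ * (y - p) ^ 2 ≤ (y - p) * deriv G y := by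
  obtain ⟨ε, hε, δ, hδ, hconv⟩ := h
  have hnhds : Ioo (p - ε) (p + ε) ∈ 𝓝 p := Ioo_mem_nhds (by linarith) (by linarith)
  have hpmem := mem_of_mem_nhds hnhds
  refine ⟨2 * δ, by positivity, mem_of_superset hnhds fun y hy => ?_⟩
  have hpy := hconv p hpmem y hy
  have hyp := hconv y hy p hpmem
  rw [hp] at hpy
  rw [mem_ofPred_eq]
  linarith

lemma StronglyConvexNear.eventually_lt (h : StronglyConvexNear G p) (hp : deriv G p = 0) :
    ∀ᶠ y in 𝓝[≠] p, G p < G y := by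
  obtain ⟨δ, hδ, hgrowth⟩ := h.exists_eventually_add_sq_le hp
  filter_upwards [hgrowth.filter_mono nhdsWithin_le_nhds, self_mem_nhdsWithin] with y hy hne
  exact (lt_add_of_pos_right _ (mul_pos hδ (sq_pos_of_ne_zero (sub_ne_zero.2 hne)))).trans_le hy

lemma StronglyConvexNear.isLocalMin (h : StronglyConvexNear G p) (hp : deriv G p = 0) :
    IsLocalMin G p := by
  obtain ⟨δ, hδ, hgrowth⟩ := h.exists_eventually_add_sq_le hp
  exact hgrowth.mono fun y hy => (le_add_of_nonneg_right (by positivity)).trans hy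

lemma StronglyConvexNear.not_isLocalMax (h : StronglyConvexNear G p) (hp : deriv G p = 0) :
    ¬ IsLocalMax G p := fun hmax => by
  obtain ⟨y, hlt, hle⟩ :=
    ((h.eventually_lt hp).and (hmax.filter_mono nhdsWithin_le_nhds)).exists
  exact hlt.not_ge hle

lemma deriv_neg_eq_zero (hp : deriv G p = 0) : deriv (fun y => -G y) p = 0 := by
  simp [deriv.fun_neg, hp]

lemma StronglyConcaveNear.exists_eventually_le_sub_sq (h : StronglyConcaveNear G p)
    (hp : deriv G p = 0) : ∃ δ > 0, ∀ᶠ y in 𝓝 p, G y ≤ G p - δ * (y - p) ^ 2 := by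
  obtain ⟨δ, hδ, hgrowth⟩ :=
    StronglyConvexNear.exists_eventually_add_sq_le h (deriv_neg_eq_zero hp)
  exact ⟨δ, hδ, hgrowth.mono fun y hy => by linarith⟩

lemma StronglyConcaveNear.isLocalMax (h : StronglyConcaveNear G p) (hp : deriv G p = 0) :
    IsLocalMax G p := by
  simpa using (StronglyConvexNear.isLocalMin h (deriv_neg_eq_zero hp)).neg

lemma StronglyConcaveNear.eventually_lt (h : StronglyConcaveNear G p) (hp : deriv G p = 0) :
    ∀ᶠ y in 𝓝[≠] p, G y < G p :=
  (StronglyConvexNear.eventually_lt h (deriv_neg_eq_zero hp)).mono fun _ => neg_lt_neg_iff.1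

lemma StronglyConcaveNear.not_isLocalMin (h : StronglyConcaveNear G p) (hp : deriv G p = 0) :
    ¬ IsLocalMin G p :=
  fun hmin => StronglyConvexNear.not_isLocalMax h (deriv_neg_eq_zero hp) hmin.neg

end LocalShape

section Convergence

variable {a G x : ℝ → ℝ} {p : ℝ}

namespace IsBoundedSolution

lemma tendsto_of_stronglyConvexNear (h : IsBoundedSolution a G x)
    (he : Tendsto (energy G x) atTop (𝓝 (G p))) (hp : ∀ q, deriv G q = 0 → G q = G p → q = p)
    (hp0 : deriv G p = 0) (hconv : StronglyConvexNear G p) : Tendsto x atTop (𝓝 p) :=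
  tendsto_of_mapClusterPt_of_strict_min h.continuousOn (h.mapClusterPt he hp)
    (fun _ hb => (he.eventually_lt_const hb).mono fun _ => potential_le_energy.trans_lt)
    (hconv.eventually_lt hp0)

lemma exists_transit_time_le_mul_log (h : IsBoundedSolution a G x)
    (he : Tendsto (energy G x) atTop (𝓝 (G p))) {δ κ : ℝ} (hδ : 0 < δ) (hκ : 0 < κ) :
    ∃ C ≥ 0, ∀ t r, 0 ≤ t → t ≤ r → (∀ s ∈ Ico t r, G (x s) ≤ G p - δ * (x s - p) ^ 2) →
      κ / (r + 2) ≤ energy G x r - energy G x (r + 1) → r ≤ t + C * Real.log (r + 2) := by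
  obtain ⟨Y, hY0, hY⟩ : ∃ Y ≥ 0, ∀ t, 0 ≤ t → |x t - p| ≤ Y := by
    obtain ⟨R, hR⟩ := h.isBounded_image.subset_closedBall p
    have hdist : ∀ t, 0 ≤ t → |x t - p| ≤ R := fun t ht => hR (mem_image_of_mem x ht)
    exact ⟨R, (abs_nonneg _).trans (hdist 0 le_rfl), hdist⟩
  obtain ⟨C, hC, hlog⟩ := exists_arsinh_mul_sqrt_le_mul_log
    (mul_nonneg hY0 (Real.sqrt_nonneg (δ / κ)))
  refine ⟨2 * C / √(2 * δ), by positivity, fun t r ht htr hdecay hdrop => ?_⟩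
  have hsqrt : 0 < √(2 * δ) := Real.sqrt_pos.2 (by positivity)
  have hlog_nonneg : 0 ≤ Real.log (r + 2) := Real.log_nonneg (by linarith)
  rcases htr.eq_or_lt with rfl | htr
  · exact le_add_of_nonneg_right (by positivity)
  have hr2 : 0 < r + 2 := by linarith
  have hspeed : ∀ s ∈ Ioo t r,
      2 * (κ / (r + 2)) + 2 * δ * (x s - p) ^ 2 ≤ velocity x s ^ 2 := by
    intro s hs
    have hs0 : 0 ≤ s := ht.trans hs.1.le
    have henergy := h.antitoneOn_energy hs0 (hs0.trans hs.2.le) hs.2.le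
    have hlimit := h.le_energy he (by linarith : 0 ≤ r + 1)
    rw [energy.eq_def G x s] at henergy
    linarith [hdecay s ⟨hs.1.le, hs.2⟩]
  have htransit := sqrt_mul_sub_le_two_mul_arsinh (f := fun s => x s - p) (by positivity)
    (by positivity) htr
    ((h.continuousOn.mono fun s hs => ht.trans hs.1).sub continuousOn_const)
    (fun s hs => (h.hasDerivAt (ht.trans_lt hs.1)).sub_const p) hspeed (hY t ht)
    (hY r (ht.trans htr.le))
  have hscale : √(2 * δ / (2 * (κ / (r + 2)))) = √(δ / κ) * √(r + 2) := by
    rw [← Real.sqrt_mul (by positivity)]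
    congr 1
    field_simp
  rw [hscale, ← mul_assoc] at htransit
  rw [← sub_le_iff_le_add', div_mul_eq_mul_div, le_div_iff₀ hsqrt]
  linarith [hlog (r + 2) (by linarith)]

/- While the motion stays near `p` it runs against the excess energy `E - G p`, which exceeds the
next drop; that drop is at least `κ / (r + 2)` when the motion leaves at time `r`. So every visit
has logarithmic length, and infinitely many exits would exhaust the energy. -/
lemma tendsto_of_stronglyConcaveNear (h : IsBoundedSolution a G x)
    (he : Tendsto (energy G x) atTop (𝓝 (G p))) (hp : ∀ q, deriv G q = 0 → G q = G p → q = p)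
    (hp0 : deriv G p = 0) (hconc : StronglyConcaveNear G p) : Tendsto x atTop (𝓝 p) := by
  obtain ⟨δ, hδ, hdecay⟩ := hconc.exists_eventually_le_sub_sq hp0
  intro V hV
  by_contra hnot
  set U := interior (V ∩ {y | G y ≤ G p - δ * (y - p) ^ 2})
  have hpU : p ∈ U := mem_interior_iff_mem_nhds.2 (inter_mem hV hdecay)
  have hexit : ∃ᶠ t in atTop, x t ∈ Uᶜ :=
    (not_eventually.1 hnot).mono fun t ht htU => ht (interior_subset htU).1
  obtain ⟨κ, hκ, hdrop⟩ := h.eventually_dissipation_of_mem he isOpen_interior.isClosed_compl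
    fun q hq hg hlevel => hq (hp q hg hlevel ▸ hpU)
  obtain ⟨C, hC, htransit⟩ := h.exists_transit_time_le_mul_log he hδ hκ
  refine not_eventually_drop_after_log_wait h.antitoneOn_energy h.bddBelow_energy hκ hC ?_
  filter_upwards [eventually_forall_ge_atTop.2 hdrop, eventually_ge_atTop 0] with t hdrop ht
  obtain ⟨u, htu, hu⟩ := frequently_atTop.1 hexit t
  obtain ⟨r, hr, hrU, hinside⟩ := exists_first_mem (h.continuousOn.mono fun s hs => ht.trans hs.1)
    isOpen_interior.isClosed_compl htu hu
  have hdrop_r := hdrop r hr.1 hrU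
  exact ⟨r, hr.1, htransit t r ht hr.1
    (fun s hs => (interior_subset (not_not.1 (hinside s hs))).2) hdrop_r, hdrop_r⟩

end IsBoundedSolution

end Convergence

section SignChanges

variable {a G x v : ℝ → ℝ} {p t : ℝ}

lemma mem_signChanges_of_hasDerivAt {v' : ℝ} (ht : 0 < t) (hvt : v t = 0)
    (hv : HasDerivAt v v' t) (hv' : v' ≠ 0) : t ∈ signChanges v := by
  have hslope : ∀ᶠ y in 𝓝[≠] t, 0 < slope v t y * v' :=
    (hv.tendsto_slope.mul_const v').eventually_const_lt (mul_self_pos.2 hv')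
  rw [eventually_nhdsWithin_iff, Metric.eventually_nhds_iff] at hslope
  obtain ⟨ε, hε, hslope⟩ := hslope
  have hsign : ∀ y, |y - t| < ε → y ≠ t → 0 < v y * v' * (y - t) := by
    intro y hy hyt
    have hne : y - t ≠ 0 := sub_ne_zero.2 hyt
    have hpos := mul_pos (hslope ((Real.dist_eq _ _).trans_lt hy) hyt) (sq_pos_of_ne_zero hne)
    rw [slope_def_field, hvt, sub_zero] at hpos
    calc 0 < v y / (y - t) * v' * (y - t) ^ 2 := hpos
      _ = v y * v' * (y - t) := by field_simp
  refine ⟨ht, min ε t, lt_min hε ht, min_le_right _ _, fun r hr s hs => ?_⟩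
  have hminε := min_le_left ε t
  have hleft := hsign r (abs_lt.2 ⟨by linarith [hr.1], by linarith [hr.2]⟩) hr.2.ne
  have hright := hsign s (abs_lt.2 ⟨by linarith [hs.1], by linarith [hs.2]⟩) hs.1.ne'
  have hleft' : v r * v' < 0 := neg_of_mul_pos_left hleft (sub_neg.2 hr.2).le
  have hright' : 0 < v s * v' := pos_of_mul_pos_left hright (sub_pos.2 hs.1).le
  nlinarith [mul_neg_of_neg_of_pos hleft' hright', sq_nonneg v']

lemma eq_zero_of_mem_signChanges (ht : t ∈ signChanges v) (hv : ContinuousAt v t) : v t = 0 := by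
  obtain ⟨-, ε, hε, -, hsign⟩ := ht
  have hlim : Tendsto (fun η => v (t - η) * v (t + η)) (𝓝[>] 0) (𝓝 (v t * v t)) := by
    have hsub : Tendsto (fun η => t - η) (𝓝 0) (𝓝 t) :=
      Continuous.tendsto' (by fun_prop) _ _ (by simp)
    have hadd : Tendsto (fun η => t + η) (𝓝 0) (𝓝 t) :=
      Continuous.tendsto' (by fun_prop) _ _ (by simp)
    exact ((hv.tendsto.comp hsub).mul (hv.tendsto.comp hadd)).mono_left nhdsWithin_le_nhds
  refine mul_self_eq_zero.1 (le_antisymm (le_of_tendsto hlim ?_) (mul_self_nonneg _))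
  filter_upwards [Ioo_mem_nhdsGT hε] with η hη
  exact (hsign _ ⟨by linarith [hη.2], by linarith [hη.1]⟩ _
    ⟨by linarith [hη.1], by linarith [hη.2]⟩).le

namespace IsSolution

/- If `x` avoided `p`, then `w = x' / (x - p)` would satisfy the Riccati equation
`w' = -a w - G'(x) / (x - p) - w²`, whose solutions blow up in finite time. -/
lemma frequently_eq_of_stronglyConvexNear (h : IsSolution a G x) (ha : Tendsto a atTop (𝓝 0))
    (hx : Tendsto x atTop (𝓝 p)) (hp0 : deriv G p = 0) (hconv : StronglyConvexNear G p) :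
    ∃ᶠ t in atTop, x t = p := by
  obtain ⟨δ, hδ, hrestoring⟩ := hconv.exists_eventually_mul_sq_le_mul_deriv hp0
  intro havoid
  have hsmall : ∀ᶠ t in atTop, a t ^ 2 < δ :=
    (ha.pow 2).eventually_lt_const (by simpa using hδ)
  obtain ⟨T, hT⟩ := eventually_atTop.1 (havoid.and
    ((hx.eventually hrestoring).and (hsmall.and (eventually_gt_atTop 0))))
  set w : ℝ → ℝ := fun t => velocity x t / (x t - p) with hw
  have hriccati : ∀ t, T ≤ t →
      HasDerivAt w (-(a t * w t) - deriv G (x t) / (x t - p) - w t ^ 2) t := by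
    intro t ht
    obtain ⟨hne, -, -, ht0⟩ := hT t ht
    have hne' : x t - p ≠ 0 := sub_ne_zero.2 hne
    refine ((h.hasDerivAt_velocity ht0).div ((h.hasDerivAt ht0).sub_const p) hne').congr_deriv ?_
    simp only [hw]
    field_simp
  obtain ⟨t, ht, hlt⟩ :=
    exists_neg_mul_one_add_sq_lt_deriv (by positivity : 0 < min δ 1 / 2) hriccati
  obtain ⟨hne, hrestoring, hsmall, -⟩ := hT t ht
  have hquot : δ ≤ deriv G (x t) / (x t - p) := by
    have hpos : 0 < (x t - p) ^ 2 := sq_pos_of_ne_zero (sub_ne_zero.2 hne)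
    rw [← mul_div_mul_left _ _ (sub_ne_zero.2 hne), ← sq, le_div_iff₀ hpos]
    exact hrestoring
  have hcδ : min δ 1 ≤ δ := min_le_left _ _
  have hcw : min δ 1 * w t ^ 2 ≤ 1 * w t ^ 2 :=
    mul_le_mul_of_nonneg_right (min_le_right _ _) (sq_nonneg _)
  linarith [sq_nonneg (a t + w t), two_mul (a t * w t)]

lemma mem_signChanges_velocity (h : IsSolution a G x) (ht : 0 < t) (hv : velocity x t = 0)
    (hg : deriv G (x t) ≠ 0) : t ∈ signChanges (velocity x) :=
  mem_signChanges_of_hasDerivAt ht hv (h.hasDerivAt_velocity ht) (by simpa [hv] using hg)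

lemma infinite_signChanges (h : IsSolution a G x)
    (hne : ∀ t, 0 ≤ t → velocity x t = 0 → deriv G (x t) ≠ 0) (hfreq : ∃ᶠ t in atTop, x t = p) :
    (signChanges (velocity x)).Infinite := by
  refine Set.infinite_of_forall_exists_gt fun M => ?_
  obtain ⟨s, hs, hxs⟩ := frequently_atTop.1 hfreq (max M 0)
  obtain ⟨t, ht, hxt⟩ := frequently_atTop.1 hfreq (s + 1)
  have hst : s < t := by linarith
  have hs0 : 0 ≤ s := (le_max_right _ _).trans hs
  obtain ⟨r, hr, hslope⟩ := h.exists_sub_eq_velocity_mul hs0 hst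
  rw [hxs, hxt, sub_self, zero_eq_mul] at hslope
  have hvr : velocity x r = 0 := hslope.resolve_right (sub_pos.2 hst).ne'
  have hr0 : 0 < r := hs0.trans_lt hr.1
  exact ⟨r, h.mem_signChanges_velocity hr0 hvr (hne r hr0.le hvr),
    ((le_max_left _ _).trans hs).trans_lt hr.1⟩

lemma finite_signChanges_of_eventually_ne (h : IsSolution a G x)
    (hne : ∀ t, 0 ≤ t → velocity x t = 0 → deriv G (x t) ≠ 0)
    (hmoving : ∀ᶠ t in atTop, velocity x t ≠ 0) : (signChanges (velocity x)).Finite := by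
  obtain ⟨T, hT⟩ := eventually_atTop.1 hmoving
  have hfinite : {t ∈ Icc 0 T | velocity x t = 0}.Finite :=
    finite_zeros_of_hasDerivWithinAt_ne_zero isCompact_Icc
      (fun t ht => (h.hasDerivWithinAt_velocity ht.1).mono Icc_subset_Ici_self)
      fun t ht hv => by simpa [hv] using hne t ht.1 hv
  refine hfinite.subset fun t ht => ?_
  have hv := eq_zero_of_mem_signChanges ht (h.hasDerivAt_velocity ht.1).continuousAt
  exact ⟨⟨ht.1.le, le_of_not_ge fun hTt => hT t hTt hv⟩, hv⟩

end IsSolution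

lemma IsBoundedSolution.eventually_velocity_ne_zero (h : IsBoundedSolution a G x)
    (hne : ∀ t, 0 ≤ t → velocity x t = 0 → deriv G (x t) ≠ 0)
    (he : Tendsto (energy G x) atTop (𝓝 (G p))) (hx : Tendsto x atTop (𝓝 p))
    (hp0 : deriv G p = 0) (hmax : ∀ᶠ y in 𝓝[≠] p, G y < G p) :
    ∀ᶠ t in atTop, velocity x t ≠ 0 := by
  filter_upwards [hx.eventually (eventually_nhdsWithin_iff.1 hmax), eventually_ge_atTop 0]
    with t hbelow ht hv
  have hxp : x t ≠ p := fun hxp => hne t ht hv (hxp ▸ hp0)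
  have henergy := h.le_energy he ht
  rw [energy, hv] at henergy
  linarith [hbelow hxp]

end SignChanges

end DampedGradient

theorem mainTheorem1_general (a : ℝ → ℝ) (ha_bdd : BddAbove (a '' Ici 0))
    (ha_lim : Tendsto a atTop (𝓝 0)) (ha_lower : ∃ c > 0, ∀ t, 0 ≤ t → c / (t + 1) ≤ a t)
    (G : ℝ → ℝ) (hG_C1 : ContDiff ℝ 1 G) (hG_distinct : InjOn G {p : ℝ | deriv G p = 0})
    (hG_strong : ∀ p, deriv G p = 0 →
      DampedGradient.StronglyConvexNear G p ∨ DampedGradient.StronglyConcaveNear G p)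
    (x : ℝ → ℝ) (hx : DampedGradient.IsSolution a G x) (hx_bdd : Bornology.IsBounded (x '' Ici 0))
    (hG_lip : ∃ K, LipschitzOnWith K (deriv G) (x '' Ici 0)) :
    ∃ l : ℝ, Tendsto x atTop (𝓝 l) ∧
      ((¬ ∃ p : ℝ, ∀ t, 0 ≤ t → x t = p) →
        (IsLocalMax G l ↔ (DampedGradient.signChanges (DampedGradient.velocity x)).Finite) ∧
        (IsLocalMin G l ↔
          (DampedGradient.signChanges (DampedGradient.velocity x)).Infinite)) := by
  have h : DampedGradient.IsBoundedSolution a G x :=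
    ⟨hx, hG_C1, hx_bdd, hG_lip, ha_bdd, ha_lower⟩
  obtain ⟨e, he⟩ := h.exists_tendsto_energy
  obtain ⟨p, hp0, rfl⟩ := h.exists_equilibrium he
  have hp : ∀ q, deriv G q = 0 → G q = G p → q = p := fun q hq => hG_distinct hq hp0
  have hne (hnc : ¬ ∃ p : ℝ, ∀ t, 0 ≤ t → x t = p) (t : ℝ) (ht : 0 ≤ t)
      (hv : DampedGradient.velocity x t = 0) : deriv G (x t) ≠ 0 :=
    fun hg => hnc ⟨x t, fun _ => h.eq_of_equilibrium ht hv hg⟩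
  rcases hG_strong p hp0 with hconv | hconc
  · have hlim := h.tendsto_of_stronglyConvexNear he hp hp0 hconv
    refine ⟨p, hlim, fun hnc => ?_⟩
    have hinf := hx.infinite_signChanges (hne hnc)
      (hx.frequently_eq_of_stronglyConvexNear ha_lim hlim hp0 hconv)
    exact ⟨iff_of_false (hconv.not_isLocalMax hp0) hinf, iff_of_true (hconv.isLocalMin hp0) hinf⟩
  · have hlim := h.tendsto_of_stronglyConcaveNear he hp hp0 hconc
    refine ⟨p, hlim, fun hnc => ?_⟩
    have hfin := hx.finite_signChanges_of_eventually_ne (hne hnc)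
      (h.eventually_velocity_ne_zero (hne hnc) he hlim hp0 (hconc.eventually_lt hp0))
    exact ⟨iff_of_true (hconc.isLocalMax hp0) hfin,
      iff_of_false (hconc.not_isLocalMin hp0) (not_not.2 hfin)⟩

theorem mainTheorem1
    (a : ℝ → ℝ)
    (ha_diff : DifferentiableOn ℝ a (Ici 0))
    (ha_nonneg : ∀ t, 0 ≤ t → 0 ≤ a t)
    (ha_anti : AntitoneOn a (Ici 0))
    (ha_lim : Tendsto a atTop (𝓝 0))
    (ha_lower : ∃ c > 0, ∀ t, 0 ≤ t → c / (t + 1) ≤ a t)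
    (G : ℝ → ℝ)
    (hG_C1 : ContDiff ℝ 1 G)
    (hG_lip : ∀ s : Set ℝ, Bornology.IsBounded s → ∃ K, LipschitzOnWith K (deriv G) s)
    (hG_coercive : Tendsto G (Bornology.cobounded ℝ) atTop)
    (hG_finite : {p : ℝ | deriv G p = 0}.Finite)
    (hG_distinct : InjOn G {p : ℝ | deriv G p = 0})
    (hG_strong : ∀ p, deriv G p = 0 →
      DampedGradient.StronglyConvexNear G p ∨ DampedGradient.StronglyConcaveNear G p)
    (x : ℝ → ℝ)
    (hx : DampedGradient.IsSolution a G x) :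
    ∃ l : ℝ, Tendsto x atTop (𝓝 l) ∧
      ((¬ ∃ p : ℝ, ∀ t, 0 ≤ t → x t = p) →
        (IsLocalMax G l ↔ (DampedGradient.signChanges (DampedGradient.velocity x)).Finite) ∧
        (IsLocalMin G l ↔ (DampedGradient.signChanges (DampedGradient.velocity x)).Infinite)) := by
  have hx_bdd := hx.isBounded_image (hG_C1.differentiable one_ne_zero) ha_nonneg hG_coercive
  exact mainTheorem1_general a ⟨a 0, forall_mem_image.2 fun _ ht => ha_anti self_mem_Ici ht ht⟩
    ha_lim ha_lower G hG_C1 hG_distinct hG_strong x hx hx_bdd (hG_lip _ hx_bdd)
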